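/- Corollary 3.1. Let $0<a\le\infty$, and let $I=[0,a]$ if $a<\infty$ and $I=[0,\infty)$ if $a=\infty$. Call $h:I\to\mathbb C$ complex analytic in $I$ if it is the restriction to $I$ of a function of a complex variable that is analytic at every point of $I$. For $0<\omega<a<\infty$ put $$\operatorname{PV}\!\!\int_0^a\frac{f(x)}{\omega-x}\,dx=\lim_{\varepsilon\to0^+}\Big(\int_0^{\omega-\varepsilon}\frac{f(x)}{\omega-x}\,dx+\int_{\omega+\varepsilon}^a\frac{f(x)}{\omega-x}\,dx\Big),$$ and put $\operatorname{PV}\!\int_0^\infty\frac{f(x)}{\omega-x}dx=\lim_{b\to\infty}\operatorname{PV}\!\int_0^b\frac{f(x)}{\omega-x}dx$. Let $f:I\to\mathbb C$ be complex analytic in $I$; if $a=\infty$, suppose moreover that $\operatorname{PV}\!\int_0^\infty\frac{f(x)}{\omega-x}dx$ exists for at least one $\omega>0$. Then $\operatorname{PV}\!\int_0^a\frac{f(x)}{\omega-x}dx$ exists for every $\omega\in(0,a)$, and the following hold. 1. If $f(0)\ne0$, then $$\operatorname{PV}\!\!\int_0^a\frac{f(x)}{\omega-x}\,dx\sim f(0)\ln\omega\qquad(\omega\to0^+).$$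 2. If $f$ has a zero of order $m\ge1$ at the origin, that is, $f(x)=x^mg(x)$ on $I$ with $g$ complex analytic in $I$ and $g(0)\neq0$, then the integral $\int_0^a x^{m-1}g(x)\,dx$ converges (for $a=\infty$ as the improper integral $\lim_{b\to\infty}\int_0^b x^{m-1}g(x)\,dx$), and if it is nonzero, then $$\operatorname{PV}\!\!\int_0^a\frac{f(x)}{\omega-x}\,dx\sim-\int_0^a x^{m-1}g(x)\,dx\qquad(\omega\to0^+).$$ Here $u\sim v$ means $u-v=o(v)$. -/

import Mathlib

open Set Filter Topology Asymptotics

/-- `f`, a function of a real variable, is complex analytic in the set `s` (an interval): on `s` it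
is the restriction of a function `F` of a complex variable that is analytic at every point of `s`
(hence on a complex neighbourhood of `s`). -/
def ComplexAnalyticIn (f : ℝ → ℂ) (s : Set ℝ) : Prop :=
  ∃ F : ℂ → ℂ, AnalyticOnNhd ℂ F ((fun x : ℝ => (x : ℂ)) '' s) ∧ ∀ x ∈ s, f x = F (x : ℂ)

/-- The Cauchy principal value `PV ∫₀ᵃ f(x) / (ω - x) dx`, for `0 < ω < a < ∞`, exists and equals
`v`: the integrals over `[0, ω - ε]` and `[ω + ε, a]` together tend to `v` as `ε → 0⁺`.
(It is used for `f` continuous on `[0, a]`, so that both integrands are integrable once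
`ε` is small.) -/
def HasPV (f : ℝ → ℂ) (a ω : ℝ) (v : ℂ) : Prop :=
  Tendsto
    (fun ε : ℝ => (∫ x in (0 : ℝ)..(ω - ε), f x / ((ω : ℂ) - (x : ℂ))) +
      ∫ x in (ω + ε)..a, f x / ((ω : ℂ) - (x : ℂ)))
    (𝓝[>] 0) (𝓝 v)

/-- The Cauchy principal value `PV ∫₀^∞ f(x) / (ω - x) dx`, for `ω > 0`, exists and equals `v`:
it is the limit of the principal values over `[0, b]` as `b → ∞`. -/
def HasPVTop (f : ℝ → ℂ) (ω : ℝ) (v : ℂ) : Prop :=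
  ∃ V : ℝ → ℂ, (∀ b : ℝ, ω < b → HasPV f b ω (V b)) ∧ Tendsto V atTop (𝓝 v)

/-! Only `C¹` regularity is used. Subtracting `f ω` removes the singularity: `f x / (ω - x)` is
`-dslope f ω x`, continuous in `x`, plus `f ω / (ω - x)`, whose principal value is `f ω * (log ω -
log (a - ω))`. So the principal value is `pvInt`. A Lipschitz bound on `f` keeps the `dslope`
integral bounded in `ω`, leaving `f ω * log ω + O(1)`, which is case 1. If `f x = x * h x`, the
principal value for `f` is `-∫ h` plus `ω` times the one for `h`; the latter is `O(log ω)`, so the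
product vanishes in the limit, which is case 2.

For `a = ∞`, cut at some `c > ω`. Convergence of the tail for one `ω₀` passes to every `ω < c` by
integration by parts (`exists_tendsto_integral_div_sub`), and the tail is continuous at `ω = 0`. It
is thus a bounded error in case 1 and supplies the rest of the integral in case 2. -/

lemma ComplexAnalyticIn.contDiffOn {f : ℝ → ℂ} {s : Set ℝ} (hf : ComplexAnalyticIn f s) :
    ContDiffOn ℝ 1 f s := by
  obtain ⟨F, hF, h⟩ := hf
  refine ContDiffOn.congr (f := fun x : ℝ => F x) (fun x hx => ?_) h
  have h1 : ContDiffAt ℝ 1 F (x : ℂ) :=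
    ((hF x (mem_image_of_mem _ hx)).contDiffAt (n := 1)).restrict_scalars ℝ
  exact (ContDiffAt.comp x h1 Complex.ofRealCLM.contDiff.contDiffAt).contDiffWithinAt

lemma exists_norm_sub_le_of_contDiffOn {f : ℝ → ℂ} {a : ℝ} (hf : ContDiffOn ℝ 1 f (Icc 0 a)) :
    ∃ K : ℝ, 0 ≤ K ∧ ∀ x ∈ Icc 0 a, ∀ y ∈ Icc 0 a, ‖f x - f y‖ ≤ K * |x - y| := by
  have h1 : LocallyLipschitzOn (Icc 0 a) f := fun x hx => by
    obtain ⟨K, t, ht, hK⟩ := (hf x hx).exists_lipschitzOnWith (convex_Icc 0 a)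
    exact ⟨K, t, ht, hK⟩
  obtain ⟨K, hK⟩ := h1.exists_lipschitzOnWith_of_compact isCompact_Icc
  refine ⟨K, K.2, fun x hx y hy => ?_⟩
  have := hK.dist_le_mul x hx y hy
  rwa [dist_eq_norm, Real.dist_eq] at this

/-! ### Principal values over a finite interval -/

/-- The value of `PV ∫₀ᵃ f(x) / (ω - x) dx` for `f` continuously differentiable. -/
noncomputable def pvInt (f : ℝ → ℂ) (a ω : ℝ) : ℂ :=
  -(∫ x in (0 : ℝ)..a, dslope f ω x) + f ω * ((Real.log ω - Real.log (a - ω) : ℝ) : ℂ)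

lemma continuousOn_dslope_Icc {f : ℝ → ℂ} {a ω : ℝ} (hf : ContDiffOn ℝ 1 f (Icc 0 a))
    (hω : ω ∈ Ioo 0 a) : ContinuousOn (dslope f ω) (Icc 0 a) := by
  have hn : Icc 0 a ∈ 𝓝 ω := Icc_mem_nhds hω.1 hω.2
  exact (continuousOn_dslope hn).2
    ⟨hf.continuousOn, (hf.contDiffAt hn).differentiableAt (by simp)⟩

lemma div_sub_eq_dslope (f : ℝ → ℂ) {ω x : ℝ} (hx : x ≠ ω) :
    f x / ((ω : ℂ) - x) = -dslope f ω x + f ω * (((ω - x)⁻¹ : ℝ) : ℂ) := by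
  have h : (x : ℂ) - ω ≠ 0 := by
    rw [sub_ne_zero]; exact_mod_cast hx
  have h' : (ω : ℂ) - x ≠ 0 := by
    rw [sub_ne_zero]; exact_mod_cast hx.symm
  rw [dslope_of_ne _ hx, slope_def_module, Complex.real_smul]
  push_cast
  field_simp
  ring

/-- As `ω` is outside the interval, `ω - p` and `ω - q` have the same sign, so one logarithm of a
quotient serves on both sides of `ω`. -/
lemma integral_div_sub_eq {f : ℝ → ℂ} {a ω p q : ℝ} (hf : ContDiffOn ℝ 1 f (Icc 0 a))
    (hω : ω ∈ Ioo 0 a) (h : uIcc p q ⊆ Icc 0 a) (hω' : ω ∉ uIcc p q) :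
    ∫ x in p..q, f x / ((ω : ℂ) - x) =
      -(∫ x in p..q, dslope f ω x) + f ω * ((Real.log ((ω - p) / (ω - q)) : ℝ) : ℂ) := by
  have hne : ∀ x ∈ uIcc p q, x ≠ ω := fun x hx e => hω' (e ▸ hx)
  have h0 : (0 : ℝ) ∉ uIcc (ω - q) (ω - p) := by
    intro h0
    apply hω'
    rw [mem_uIcc] at h0 ⊢
    rcases h0 with h0 | h0
    · exact Or.inl ⟨by linarith, by linarith⟩
    · exact Or.inr ⟨by linarith, by linarith⟩
  have hi : ∫ x in p..q, (ω - x)⁻¹ = Real.log ((ω - p) / (ω - q)) := by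
    rw [intervalIntegral.integral_comp_sub_left (fun x => x⁻¹), integral_inv h0]
  rw [intervalIntegral.integral_congr (fun x hx => div_sub_eq_dslope f (hne x hx)),
    intervalIntegral.integral_add, intervalIntegral.integral_neg,
    intervalIntegral.integral_const_mul, intervalIntegral.integral_ofReal, hi]
  · exact ((continuousOn_dslope_Icc hf hω).mono h).neg.intervalIntegrable
  · apply ContinuousOn.intervalIntegrable
    refine continuousOn_const.mul (Complex.continuous_ofReal.comp_continuousOn ?_)
    exact (continuousOn_const.sub continuousOn_id).inv₀ fun x hx => sub_ne_zero.2 (hne x hx).symm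

/-- The two `log ε` terms cancel by symmetry of the excision; continuity of the primitive of `dslope
f ω` at `ω` does the rest. -/
lemma hasPV_pvInt {f : ℝ → ℂ} {a ω : ℝ} (hf : ContDiffOn ℝ 1 f (Icc 0 a)) (hω : ω ∈ Ioo 0 a) :
    HasPV f a ω (pvInt f a ω) := by
  obtain ⟨h0, ha⟩ := hω
  have hd := continuousOn_dslope_Icc hf ⟨h0, ha⟩
  have ha0 : 0 ≤ a := (h0.trans ha).le
  set G : ℝ → ℂ := fun t => ∫ x in (0 : ℝ)..t, dslope f ω x with hG
  have hint : ∀ p ∈ Icc 0 a, ∀ q ∈ Icc 0 a,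
      IntervalIntegrable (dslope f ω) MeasureTheory.volume p q := fun p hp q hq =>
    (hd.mono ((convex_Icc 0 a).ordConnected.uIcc_subset hp hq)).intervalIntegrable
  have hGc : ContinuousAt G ω := by
    have h1 : ContinuousOn G (Icc 0 a) := by
      have := intervalIntegral.continuousOn_primitive_interval
        (μ := MeasureTheory.volume) (f := dslope f ω) (a := 0) (b := a)
        (by rw [uIcc_of_le ha0]; exact hd.integrableOn_Icc)
      rwa [uIcc_of_le ha0] at this
    exact h1.continuousAt (Icc_mem_nhds h0 ha)
  have hlim : Tendsto (fun ε : ℝ => -(G (ω - ε)) - (G a - G (ω + ε)) +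
      f ω * ((Real.log ω - Real.log (a - ω) : ℝ) : ℂ)) (𝓝[>] 0) (𝓝 (pvInt f a ω)) := by
    have h1 : Tendsto (fun ε : ℝ => ω - ε) (𝓝[>] 0) (𝓝 ω) := by
      have : Tendsto (fun ε : ℝ => ω - ε) (𝓝 0) (𝓝 (ω - 0)) :=
        (continuous_const.sub continuous_id).tendsto 0
      rw [sub_zero] at this
      exact this.mono_left nhdsWithin_le_nhds
    have h2 : Tendsto (fun ε : ℝ => ω + ε) (𝓝[>] 0) (𝓝 ω) := by
      have : Tendsto (fun ε : ℝ => ω + ε) (𝓝 0) (𝓝 (ω + 0)) :=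
        (continuous_const.add continuous_id).tendsto 0
      rw [add_zero] at this
      exact this.mono_left nhdsWithin_le_nhds
    have h3 := (((hGc.tendsto.comp h1).neg.sub ((hGc.tendsto.comp h2).const_sub (G a))).add_const
      (f ω * ((Real.log ω - Real.log (a - ω) : ℝ) : ℂ)))
    have e : -G ω - (G a - G ω) + f ω * ((Real.log ω - Real.log (a - ω) : ℝ) : ℂ) =
        pvInt f a ω := by
      simp only [pvInt, hG]; ring
    rw [e] at h3
    exact h3
  refine hlim.congr' ?_
  have hm : Ioo 0 (min ω (a - ω)) ∈ 𝓝[>] (0 : ℝ) :=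
    Ioo_mem_nhdsGT (lt_min h0 (by linarith))
  filter_upwards [hm] with ε hε
  obtain ⟨hε0, hε1⟩ := hε
  rw [lt_min_iff] at hε1
  obtain ⟨hε1, hε2⟩ := hε1
  have m0 : (0 : ℝ) ∈ Icc 0 a := ⟨le_rfl, ha0⟩
  have ma : a ∈ Icc 0 a := ⟨ha0, le_rfl⟩
  have m1 : ω - ε ∈ Icc 0 a := ⟨by linarith, by linarith⟩
  have m2 : ω + ε ∈ Icc 0 a := ⟨by linarith, by linarith⟩
  have oc := (convex_Icc (0 : ℝ) a).ordConnected
  rw [integral_div_sub_eq hf ⟨h0, ha⟩ (oc.uIcc_subset m0 m1)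
      (by rw [uIcc_of_le m1.1]; rintro ⟨-, h⟩; linarith),
    integral_div_sub_eq hf ⟨h0, ha⟩ (oc.uIcc_subset m2 ma)
      (by rw [uIcc_of_le m2.2]; rintro ⟨h, -⟩; linarith)]
  have hs : ∫ x in (ω + ε)..a, dslope f ω x = G a - G (ω + ε) :=
    (intervalIntegral.integral_interval_sub_left (hint 0 m0 a ma) (hint 0 m0 _ m2)).symm
  have l1 : Real.log ((ω - 0) / (ω - (ω - ε))) = Real.log ω - Real.log ε := by
    rw [sub_zero, sub_sub_cancel, Real.log_div h0.ne' hε0.ne']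
  have l2 : Real.log ((ω - (ω + ε)) / (ω - a)) = Real.log ε - Real.log (a - ω) := by
    rw [show (ω - (ω + ε)) / (ω - a) = ε / (a - ω) by
      rw [show ω - (ω + ε) = -ε by ring, show ω - a = -(a - ω) by ring, neg_div_neg_eq],
      Real.log_div hε0.ne' (by linarith)]
  rw [hs, l1, l2]
  push_cast
  ring

lemma HasPV.unique {f : ℝ → ℂ} {a ω : ℝ} {v w : ℂ} (hv : HasPV f a ω v) (hw : HasPV f a ω w) :
    v = w :=
  tendsto_nhds_unique hv hw

/-! ### Behaviour as `ω → 0⁺` on a finite interval -/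

lemma exists_norm_integral_dslope_le {f : ℝ → ℂ} {a : ℝ} (hf : ContDiffOn ℝ 1 f (Icc 0 a)) :
    ∃ C : ℝ, ∀ ω ∈ Ioo 0 a, ‖∫ x in (0 : ℝ)..a, dslope f ω x‖ ≤ C := by
  obtain ⟨K, hK0, hK⟩ := exists_norm_sub_le_of_contDiffOn hf
  refine ⟨K * |a - 0|, fun ω hω => ?_⟩
  refine intervalIntegral.norm_integral_le_of_norm_le_const_ae ?_
  -- At `x = ω` `dslope` is a derivative, not a difference quotient; this null set is discarded.
  have : ∀ᵐ x : ℝ, x ≠ ω := by simp [MeasureTheory.ae_iff]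
  filter_upwards [this] with x hx hx'
  rw [uIoc_of_le (hω.1.trans hω.2).le] at hx'
  rw [dslope_of_ne _ hx, slope_def_module, norm_smul, norm_inv, Real.norm_eq_abs,
    inv_mul_le_iff₀ (abs_pos.2 (sub_ne_zero.2 hx)), mul_comm]
  exact hK x ⟨hx'.1.le, hx'.2⟩ ω ⟨hω.1.le, hω.2.le⟩

lemma tendsto_nhdsGT_zero_of_contDiffOn {f : ℝ → ℂ} {a : ℝ} (ha : 0 < a)
    (hf : ContDiffOn ℝ 1 f (Icc 0 a)) : Tendsto f (𝓝[>] 0) (𝓝 (f 0)) := by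
  have h := hf.continuousOn 0 ⟨le_rfl, ha.le⟩
  refine h.mono_left ?_
  rw [← nhdsWithin_Ioo_eq_nhdsGT ha]
  exact nhdsWithin_mono _ Ioo_subset_Icc_self

/-- Up to a bounded error, `pvInt f a ω` is `f ω * log ω`. -/
lemma pvInt_sub_isBigO_one {f : ℝ → ℂ} {a : ℝ} (ha : 0 < a) (hf : ContDiffOn ℝ 1 f (Icc 0 a)) :
    (fun ω => pvInt f a ω - f ω * ((Real.log ω : ℝ) : ℂ)) =O[𝓝[>] 0] (fun _ => (1 : ℝ)) := by
  obtain ⟨C, hC⟩ := exists_norm_integral_dslope_le hf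
  have h1 : (fun ω => -∫ x in (0 : ℝ)..a, dslope f ω x) =O[𝓝[>] 0] (fun _ => (1 : ℝ)) := by
    refine IsBigO.of_bound C ?_
    filter_upwards [Ioo_mem_nhdsGT ha] with ω hω
    rw [norm_neg]
    simpa using hC ω hω
  have h2 : Tendsto (fun ω : ℝ => ((Real.log (a - ω) : ℝ) : ℂ)) (𝓝[>] 0)
      (𝓝 ((Real.log (a - 0) : ℝ) : ℂ)) := by
    have : ContinuousAt (fun ω : ℝ => ((Real.log (a - ω) : ℝ) : ℂ)) 0 :=
      Complex.continuous_ofReal.continuousAt.comp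
        (ContinuousAt.log (by fun_prop) (by simpa using ha.ne'))
    exact this.tendsto.mono_left nhdsWithin_le_nhds
  have h3 := ((tendsto_nhdsGT_zero_of_contDiffOn ha hf).mul h2).isBigO_one ℝ
  refine (h1.sub h3).congr_left fun ω => ?_
  simp only [pvInt]
  push_cast
  ring

lemma one_isLittleO_log_nhdsGT_zero :
    (fun _ : ℝ => (1 : ℝ)) =o[𝓝[>] 0] (fun ω : ℝ => ((Real.log ω : ℝ) : ℂ)) := by
  rw [isLittleO_const_left]
  right
  have : Tendsto (fun ω => |Real.log ω|) (𝓝[>] 0) atTop :=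
    tendsto_abs_atBot_atTop.comp Real.tendsto_log_nhdsGT_zero
  refine this.congr fun ω => ?_
  simp

/-- `T` is zero for finite `a` and the tail integral for `a = ∞`. -/
lemma isEquivalent_mul_log {P f : ℝ → ℂ} {a : ℝ} {T : ℝ → ℂ} (ha : 0 < a)
    (hf : ContDiffOn ℝ 1 f (Icc 0 a)) (h0 : f 0 ≠ 0)
    (hT : T =O[𝓝[>] 0] (fun _ => (1 : ℝ))) (hP : P =ᶠ[𝓝[>] 0] fun ω => pvInt f a ω + T ω) :
    P ~[𝓝[>] 0] (fun ω : ℝ => f 0 * ((Real.log ω : ℝ) : ℂ)) := by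
  have h1 : (fun ω => (pvInt f a ω - f ω * ((Real.log ω : ℝ) : ℂ)) + T ω)
      =o[𝓝[>] 0] (fun ω : ℝ => ((Real.log ω : ℝ) : ℂ)) :=
    ((pvInt_sub_isBigO_one ha hf).add hT).trans_isLittleO one_isLittleO_log_nhdsGT_zero
  have h2 : (fun ω => (f ω - f 0) * ((Real.log ω : ℝ) : ℂ))
      =o[𝓝[>] 0] (fun ω : ℝ => ((Real.log ω : ℝ) : ℂ)) := by
    have h3 : (fun ω => f ω - f 0) =o[𝓝[>] 0] (fun _ => (1 : ℂ)) := by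
      rw [isLittleO_one_iff]
      simpa using (tendsto_nhdsGT_zero_of_contDiffOn ha hf).sub_const (f 0)
    simpa using h3.mul_isBigO (isBigO_refl (fun ω : ℝ => ((Real.log ω : ℝ) : ℂ)) _)
  have h4 : (fun ω => P ω - f 0 * ((Real.log ω : ℝ) : ℂ))
      =o[𝓝[>] 0] (fun ω : ℝ => ((Real.log ω : ℝ) : ℂ)) := by
    refine (h1.add h2).congr' ?_ EventuallyEq.rfl
    filter_upwards [hP] with ω hω
    rw [hω]
    ring
  exact h4.const_mul_right h0

/-- Splitting off a factor `x`: `x h(x) / (ω - x) = -h(x) + ω h(x) / (ω - x)`. -/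
lemma pvInt_mul_id {f h : ℝ → ℂ} {a ω : ℝ} (hh : ContDiffOn ℝ 1 h (Icc 0 a)) (hω : ω ∈ Ioo 0 a)
    (hfh : ∀ x ∈ Icc 0 a, f x = x * h x) :
    pvInt f a ω = -(∫ x in (0 : ℝ)..a, h x) + ω * pvInt h a ω := by
  have ha : 0 ≤ a := (hω.1.trans hω.2).le
  have key : ∫ x in (0 : ℝ)..a, dslope f ω x = ∫ x in (0 : ℝ)..a, (h x + ω * dslope h ω x) := by
    refine intervalIntegral.integral_congr_ae ?_
    have : ∀ᵐ x : ℝ, x ≠ ω := by simp [MeasureTheory.ae_iff]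
    filter_upwards [this] with x hx hx'
    rw [uIoc_of_le ha] at hx'
    have hne : (x : ℂ) - ω ≠ 0 := by
      rw [sub_ne_zero]; exact_mod_cast hx
    rw [dslope_of_ne _ hx, dslope_of_ne _ hx, slope_def_module, slope_def_module,
      Complex.real_smul, Complex.real_smul, hfh x ⟨hx'.1.le, hx'.2⟩, hfh ω ⟨hω.1.le, hω.2.le⟩]
    push_cast
    field_simp
    ring
  have hsub : uIcc 0 a ⊆ Icc 0 a := by rw [uIcc_of_le ha]
  rw [intervalIntegral.integral_add (hh.continuousOn.mono hsub).intervalIntegrable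
    (((continuousOn_dslope_Icc hh hω).mono hsub).intervalIntegrable.const_mul _),
    intervalIntegral.integral_const_mul] at key
  simp only [pvInt]
  rw [key, hfh ω ⟨hω.1.le, hω.2.le⟩]
  ring

/-- The remainder `ω * pvInt h a ω` is `ω * O(1) + h ω * (ω * log ω)`, and both terms tend to `0`.
-/
lemma tendsto_pvInt_mul_id {f h : ℝ → ℂ} {a : ℝ} (ha : 0 < a) (hh : ContDiffOn ℝ 1 h (Icc 0 a))
    (hfh : ∀ x ∈ Icc 0 a, f x = x * h x) :
    Tendsto (pvInt f a) (𝓝[>] 0) (𝓝 (-∫ x in (0 : ℝ)..a, h x)) := by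
  have hid : Tendsto (fun ω : ℝ => (ω : ℂ)) (𝓝[>] 0) (𝓝 0) := by
    have : Tendsto (fun ω : ℝ => (ω : ℂ)) (𝓝 0) (𝓝 ((0 : ℝ) : ℂ)) :=
      Complex.continuous_ofReal.tendsto 0
    rw [Complex.ofReal_zero] at this
    exact this.mono_left nhdsWithin_le_nhds
  have h1 : Tendsto (fun ω : ℝ => (ω : ℂ) * (pvInt h a ω - h ω * ((Real.log ω : ℝ) : ℂ)))
      (𝓝[>] 0) (𝓝 0) := by
    have := ((isLittleO_one_iff ℝ).2 hid).mul_isBigO (pvInt_sub_isBigO_one ha hh)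
    simpa [isLittleO_one_iff] using this
  have h2 : Tendsto (fun ω : ℝ => h ω * ((Real.log ω * ω : ℝ) : ℂ)) (𝓝[>] 0) (𝓝 0) := by
    have h3 : Tendsto (fun ω : ℝ => ((Real.log ω * ω : ℝ) : ℂ)) (𝓝[>] 0) (𝓝 0) := by
      have := (Complex.continuous_ofReal.comp Real.continuous_mul_log).tendsto 0
      simp only [Function.comp_apply, zero_mul, Complex.ofReal_zero] at this
      exact (this.mono_left nhdsWithin_le_nhds).congr fun ω => by
        simp only [Function.comp_apply, mul_comm]
    simpa using (tendsto_nhdsGT_zero_of_contDiffOn ha hh).mul h3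
  have h4 := (h1.add h2).const_add (-∫ x in (0 : ℝ)..a, h x)
  rw [add_zero, add_zero] at h4
  refine h4.congr' ?_
  filter_upwards [Ioo_mem_nhdsGT ha] with ω hω
  rw [pvInt_mul_id hh hω hfh]
  push_cast
  ring

/-! ### The tail integral as a function of `ω` -/

lemma integrableOn_inv_sub_sq {ω c : ℝ} (h : ω < c) :
    MeasureTheory.IntegrableOn (fun x : ℝ => ((x - ω) ^ 2)⁻¹) (Ioi c) := by
  have h1 := integrableOn_add_rpow_Ioi_of_lt (a := -2) (m := -ω) (c := c) (by norm_num)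
    (by simpa using h)
  refine h1.congr_fun (fun x hx => ?_) measurableSet_Ioi
  have hx' : 0 ≤ x + -ω := by
    have : c < x := hx
    linarith
  simp only
  rw [Real.rpow_neg hx', Real.rpow_two, sub_eq_add_neg]

lemma exists_norm_le_of_tendsto_atTop {U : ℝ → ℂ} {c : ℝ} {l : ℂ} (hU : ContinuousOn U (Ici c))
    (hl : Tendsto U atTop (𝓝 l)) : ∃ K : ℝ, ∀ x ∈ Ici c, ‖U x‖ ≤ K := by
  have h1 : ∀ᶠ x in atTop, ‖U x‖ < ‖l‖ + 1 := hl.norm.eventually_lt_const (lt_add_one _)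
  obtain ⟨B, hB⟩ := eventually_atTop.1 h1
  obtain ⟨M, hM⟩ := isCompact_Icc.exists_bound_of_continuousOn
    (hU.mono (Icc_subset_Ici_self : Icc c B ⊆ Ici c))
  refine ⟨max M (‖l‖ + 1), fun x hx => ?_⟩
  rcases le_total x B with h | h
  · exact (hM x ⟨hx, h⟩).trans (le_max_left _ _)
  · exact (hB x h).le.trans (le_max_right _ _)

lemma continuousOn_div_sub {f : ℝ → ℂ} {ω : ℝ} (hf : ContinuousOn f (Ici 0)) (hω : 0 ≤ ω) :
    ContinuousOn (fun x : ℝ => f x / ((ω : ℂ) - x)) (Ioi ω) := by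
  refine (hf.mono fun x (hx : ω < x) => (hω.trans hx.le : (0 : ℝ) ≤ x)).div ?_ ?_
  · exact continuousOn_const.sub Complex.continuous_ofReal.continuousOn
  · intro x hx
    have : ω ≠ x := ne_of_lt hx
    rw [sub_ne_zero]
    exact_mod_cast this

/-- Dirichlet's test: convergence of `∫_c^∞ f(x) / (ω₀ - x) dx` for one `ω₀ < c` gives it for all
`ω < c`, with a value continuous at `ω = 0`. -/
lemma exists_tendsto_integral_div_sub {f : ℝ → ℂ} (hf : ContinuousOn f (Ici 0)) {ω₀ c : ℝ} {l : ℂ}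
    (h0 : 0 < ω₀) (hc : ω₀ < c)
    (hl : Tendsto (fun b : ℝ => ∫ x in c..b, f x / ((ω₀ : ℂ) - x)) atTop (𝓝 l)) :
    ∃ T : ℝ → ℂ, ContinuousAt T 0 ∧
      ∀ ω < c, Tendsto (fun b : ℝ => ∫ x in c..b, f x / ((ω : ℂ) - x)) atTop (𝓝 (T ω)) := by
  have hφ := continuousOn_div_sub hf h0.le
  set φ : ℝ → ℂ := fun x => f x / ((ω₀ : ℂ) - x) with hφdef
  set U : ℝ → ℂ := fun b => ∫ x in c..b, φ x with hUdef
  have hsub : ∀ b, c ≤ b → uIcc c b ⊆ Ioi ω₀ := fun b hb x hx => by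
    rw [uIcc_of_le hb] at hx
    exact hc.trans_le hx.1
  have hφi : ∀ b, c ≤ b → IntervalIntegrable φ MeasureTheory.volume c b := fun b hb =>
    (hφ.mono (hsub b hb)).intervalIntegrable
  have hU' : ∀ x, c ≤ x → HasDerivAt U (φ x) x := fun x hx =>
    intervalIntegral.integral_hasDerivAt_right (hφi x hx)
      (hφ.stronglyMeasurableAtFilter isOpen_Ioi x (hc.trans_le hx))
      (hφ.continuousAt (Ioi_mem_nhds (hc.trans_le hx)))
  have hUc : ContinuousOn U (Ici c) := fun x hx => (hU' x hx).continuousAt.continuousWithinAt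
  obtain ⟨K, hK⟩ := exists_norm_le_of_tendsto_atTop hUc hl
  have hK0 : 0 ≤ K := (norm_nonneg _).trans (hK c self_mem_Ici)
  have hne : ∀ {ω x : ℝ}, ω < x → (ω : ℂ) - x ≠ 0 := fun {ω x} h => by
    rw [sub_ne_zero]
    exact_mod_cast h.ne
  have hWc : ∀ ω < c, ContinuousOn (fun x : ℝ => (((ω : ℂ) - x) ^ 2)⁻¹) (Ici c) := fun ω hω => by
    refine ContinuousOn.inv₀ (by fun_prop) fun x hx => pow_ne_zero _ (hne (hω.trans_le hx))
  have hbound : ∀ ω x : ℝ, x ∈ Ioi c →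
      ‖(((ω : ℂ) - x) ^ 2)⁻¹ * U x‖ ≤ ((x - ω) ^ 2)⁻¹ * K := fun ω x hx => by
    have e : ‖(((ω : ℂ) - x) ^ 2)⁻¹‖ = ((x - ω) ^ 2)⁻¹ := by
      rw [norm_inv, norm_pow, ← Complex.ofReal_sub, Complex.norm_real, Real.norm_eq_abs, sq_abs]
      congr 1
      ring
    rw [norm_mul, e]
    exact mul_le_mul_of_nonneg_left (hK x (Ioi_subset_Ici_self hx)) (by positivity)
  have hmeas : ∀ ω < c, MeasureTheory.AEStronglyMeasurable
      (fun x : ℝ => (((ω : ℂ) - x) ^ 2)⁻¹ * U x) (MeasureTheory.volume.restrict (Ioi c)) :=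
    fun ω hω => (((hWc ω hω).mul hUc).mono Ioi_subset_Ici_self).aestronglyMeasurable
      measurableSet_Ioi
  have hint : ∀ ω < c, MeasureTheory.IntegrableOn
      (fun x : ℝ => (((ω : ℂ) - x) ^ 2)⁻¹ * U x) (Ioi c) := fun ω hω => by
    refine MeasureTheory.Integrable.mono' ((integrableOn_inv_sub_sq hω).mul_const K)
      (hmeas ω hω) ?_
    filter_upwards [MeasureTheory.ae_restrict_mem measurableSet_Ioi] with x hx
    exact hbound ω x hx
  -- Integrating by parts against the bounded primitive `U` gives `U b + (ω₀ - ω) * (U b / (ω - b) -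
  -- ∫ U x / (ω - x)²)` over `[c, b]`; this is its limit as `b → ∞`.
  refine ⟨fun ω => l - ((ω₀ : ℂ) - ω) * ∫ x in Ioi c, (((ω : ℂ) - x) ^ 2)⁻¹ * U x, ?_, ?_⟩
  · have hcI : ContinuousAt (fun ω : ℝ => ∫ x in Ioi c, (((ω : ℂ) - x) ^ 2)⁻¹ * U x) 0 := by
      -- Keeping `ω < c / 2` gives one integrable majorant for all `ω` near `0`.
      have hc2 : c / 2 < c := by linarith
      have hev : ∀ᶠ ω : ℝ in 𝓝 0, ω < c / 2 := eventually_lt_nhds (by linarith)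
      refine MeasureTheory.continuousAt_of_dominated
        (bound := fun x : ℝ => ((x - c / 2) ^ 2)⁻¹ * K) ?_ ?_
        ((integrableOn_inv_sub_sq hc2).mul_const K) ?_
      · filter_upwards [hev] with ω hω
        exact hmeas ω (hω.trans hc2)
      · filter_upwards [hev] with ω hω
        filter_upwards [MeasureTheory.ae_restrict_mem measurableSet_Ioi] with x hx
        refine (hbound ω x hx).trans ?_
        have hx' : c < x := hx
        have h1 : 0 < x - c / 2 := by linarith
        have h2 : x - c / 2 ≤ x - ω := by linarith
        gcongr
      · filter_upwards [MeasureTheory.ae_restrict_mem measurableSet_Ioi] with x hx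
        have hx' : c < x := hx
        have h1 : (((0 : ℝ) : ℂ) - x) ^ 2 ≠ 0 := pow_ne_zero _ (hne (by linarith))
        exact ContinuousAt.mul (ContinuousAt.inv₀ (by fun_prop) h1) continuousAt_const
    have hl0 : ContinuousAt (fun ω : ℝ => (ω₀ : ℂ) - ω) 0 := by fun_prop
    exact continuousAt_const.sub (hl0.mul hcI)
  · intro ω hω
    have hW0 : Tendsto (fun b : ℝ => ((ω : ℂ) - b)⁻¹) atTop (𝓝 0) := by
      refine tendsto_inv₀_cobounded.comp ?_
      rw [← tendsto_norm_atTop_iff_cobounded]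
      refine tendsto_atTop_mono (f := fun b : ℝ => b - ω) (fun b => ?_)
        (tendsto_atTop_add_const_right _ _ tendsto_id)
      rw [← Complex.ofReal_sub, Complex.norm_real, Real.norm_eq_abs, abs_sub_comm]
      exact le_abs_self _
    have hI := MeasureTheory.intervalIntegral_tendsto_integral_Ioi c (hint ω hω) tendsto_id
    have hlim := hl.add (((hW0.mul hl).sub hI).const_mul ((ω₀ : ℂ) - ω))
    have e : l + ((ω₀ : ℂ) - ω) * (0 * l - ∫ x in Ioi c, (((ω : ℂ) - x) ^ 2)⁻¹ * U x) =
        l - ((ω₀ : ℂ) - ω) * ∫ x in Ioi c, (((ω : ℂ) - x) ^ 2)⁻¹ * U x := by ring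
    rw [e] at hlim
    refine hlim.congr' ?_
    filter_upwards [eventually_ge_atTop c] with b hb
    have hW' : ∀ x ∈ uIcc c b, HasDerivAt (fun x : ℝ => ((ω : ℂ) - x)⁻¹)
        ((((ω : ℂ) - x) ^ 2)⁻¹) x := fun x hx => by
      rw [uIcc_of_le hb] at hx
      have h1 : HasDerivAt (fun x : ℝ => (ω : ℂ) - x) (-1) x := by
        simpa using (Complex.ofRealCLM.hasDerivAt (x := x)).const_sub (ω : ℂ)
      have := h1.fun_inv (hne (hω.trans_le hx.1))
      simpa [neg_div, one_div] using this
    have hIcc : uIcc c b ⊆ Ici c := by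
      rw [uIcc_of_le hb]
      exact Icc_subset_Ici_self
    have hWφ : IntervalIntegrable (fun x : ℝ => ((ω : ℂ) - x)⁻¹ * φ x)
        MeasureTheory.volume c b := by
      refine ContinuousOn.intervalIntegrable (ContinuousOn.mul ?_ (hφ.mono (hsub b hb)))
      exact fun x hx => (hW' x hx).continuousAt.continuousWithinAt
    have hparts := intervalIntegral.integral_mul_deriv_eq_deriv_mul hW'
      (fun x hx => hU' x (hIcc hx)) ((hWc ω hω).mono hIcc).intervalIntegrable (hφi b hb)
    have hUcc : U c = 0 := intervalIntegral.integral_same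
    rw [hUcc, mul_zero, sub_zero] at hparts
    -- This is `(ω₀ - x) / (ω - x) = 1 + (ω₀ - ω) / (ω - x)`, multiplied by `φ x`.
    have hsplit : ∫ x in c..b, f x / ((ω : ℂ) - x) =
        ∫ x in c..b, (φ x + ((ω₀ : ℂ) - ω) * (((ω : ℂ) - x)⁻¹ * φ x)) := by
      refine intervalIntegral.integral_congr fun x hx => ?_
      have hx' := hIcc hx
      have h1 := hne (hc.trans_le hx')
      have h2 := hne (hω.trans_le hx')
      simp only [hφdef]
      field_simp
      ring
    rw [hsplit, intervalIntegral.integral_add (hφi b hb) (hWφ.const_mul _),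
      intervalIntegral.integral_const_mul, hparts]
    rfl

/-! ### Principal values over the half-line -/

lemma pvInt_eq_add {f : ℝ → ℂ} (hf : ContDiffOn ℝ 1 f (Ici 0)) {ω c b : ℝ} (h0 : 0 < ω)
    (hc : ω < c) (hb : ω < b) :
    pvInt f b ω = pvInt f c ω + ∫ x in c..b, f x / ((ω : ℂ) - x) := by
  have hφ := continuousOn_div_sub hf.continuousOn h0.le
  have hint : ∀ p q : ℝ, ω < p → ω < q →
      IntervalIntegrable (fun x : ℝ => f x / ((ω : ℂ) - x)) MeasureTheory.volume p q :=
    fun p q hp hq => (hφ.mono ((convex_Ioi ω).ordConnected.uIcc_subset hp hq)).intervalIntegrable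
  refine HasPV.unique (hasPV_pvInt (hf.mono Icc_subset_Ici_self) ⟨h0, hb⟩) ?_
  have h1 := (hasPV_pvInt (hf.mono Icc_subset_Ici_self) ⟨h0, hc⟩).add_const
    (∫ x in c..b, f x / ((ω : ℂ) - x))
  refine h1.congr' ?_
  filter_upwards [self_mem_nhdsWithin] with ε hε
  have hε' : ω < ω + ε := lt_add_of_pos_right _ hε
  rw [add_assoc, intervalIntegral.integral_add_adjacent_intervals (hint _ _ hε' hc)
    (hint _ _ hc hb)]

lemma HasPVTop.tendsto_integral {f : ℝ → ℂ} (hf : ContDiffOn ℝ 1 f (Ici 0)) {ω c : ℝ} {v : ℂ}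
    (h0 : 0 < ω) (hc : ω < c) (h : HasPVTop f ω v) :
    Tendsto (fun b : ℝ => ∫ x in c..b, f x / ((ω : ℂ) - x)) atTop (𝓝 (v - pvInt f c ω)) := by
  obtain ⟨V, hV, hlim⟩ := h
  refine (hlim.sub_const (pvInt f c ω)).congr' ?_
  filter_upwards [eventually_gt_atTop ω] with b hb
  rw [(hV b hb).unique (hasPV_pvInt (hf.mono Icc_subset_Ici_self) ⟨h0, hb⟩),
    pvInt_eq_add hf h0 hc hb, add_sub_cancel_left]

lemma hasPVTop_of_tendsto {f : ℝ → ℂ} (hf : ContDiffOn ℝ 1 f (Ici 0)) {ω c : ℝ} {t : ℂ}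
    (h0 : 0 < ω) (hc : ω < c)
    (h : Tendsto (fun b : ℝ => ∫ x in c..b, f x / ((ω : ℂ) - x)) atTop (𝓝 t)) :
    HasPVTop f ω (pvInt f c ω + t) := by
  refine ⟨fun b => pvInt f b ω, fun b hb =>
    hasPV_pvInt (hf.mono Icc_subset_Ici_self) ⟨h0, hb⟩, (h.const_add _).congr' ?_⟩
  filter_upwards [eventually_gt_atTop ω] with b hb
  rw [pvInt_eq_add hf h0 hc hb]

lemma HasPVTop.unique {f : ℝ → ℂ} {ω : ℝ} {v w : ℂ} (hv : HasPVTop f ω v) (hw : HasPVTop f ω w) :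
    v = w := by
  obtain ⟨V, hV, hVl⟩ := hv
  obtain ⟨W, hW, hWl⟩ := hw
  refine tendsto_nhds_unique (hVl.congr' ?_) hWl
  filter_upwards [eventually_gt_atTop ω] with b hb
  exact (hV b hb).unique (hW b hb)

/-- Existence at a given `ω` needs a cut point beyond both `ω₀` and `ω`; the asymptotics need one
fixed cut `c`. Uniqueness of the principal value reconciles the two near `0`. -/
lemma exists_hasPVTop {f : ℝ → ℂ} (hf : ContDiffOn ℝ 1 f (Ici 0))
    (h : ∃ ω > 0, ∃ v : ℂ, HasPVTop f ω v) :
    ∃ (P T : ℝ → ℂ) (c : ℝ), 0 < c ∧ (∀ ω > 0, HasPVTop f ω (P ω)) ∧ ContinuousAt T 0 ∧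
      Tendsto (fun b : ℝ => ∫ x in c..b, f x / (((0 : ℝ) : ℂ) - x)) atTop (𝓝 (T 0)) ∧
      P =ᶠ[𝓝[>] 0] fun ω => pvInt f c ω + T ω := by
  obtain ⟨ω₀, h0, v, hv⟩ := h
  have hex : ∀ ω : ℝ, ∃ p, 0 < ω → HasPVTop f ω p := fun ω => by
    by_cases hω : 0 < ω
    · have hc : ω₀ < max ω₀ ω + 1 := (le_max_left _ _).trans_lt (lt_add_one _)
      have hc' : ω < max ω₀ ω + 1 := (le_max_right _ _).trans_lt (lt_add_one _)
      obtain ⟨T, -, hT⟩ := exists_tendsto_integral_div_sub hf.continuousOn h0 hc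
        (hv.tendsto_integral hf h0 hc)
      exact ⟨_, fun _ => hasPVTop_of_tendsto hf hω hc' (hT ω hc')⟩
    · exact ⟨0, fun h => absurd h hω⟩
  choose P hP using hex
  have hc := lt_add_one ω₀
  obtain ⟨T, hTc, hT⟩ := exists_tendsto_integral_div_sub hf.continuousOn h0 hc
    (hv.tendsto_integral hf h0 hc)
  refine ⟨P, T, ω₀ + 1, by linarith, hP, hTc, hT 0 (by linarith), ?_⟩
  filter_upwards [Ioo_mem_nhdsGT (h0.trans hc)] with ω hω
  exact (hP ω hω.1).unique (hasPVTop_of_tendsto hf hω.1 hω.2 (hT ω hω.2))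

lemma ComplexAnalyticIn.contDiffOn_pow_mul {g : ℝ → ℂ} {s : Set ℝ} (hg : ComplexAnalyticIn g s)
    (n : ℕ) : ContDiffOn ℝ 1 (fun x : ℝ => (x : ℂ) ^ n * g x) s :=
  (Complex.ofRealCLM.contDiff.contDiffOn.pow n).mul hg.contDiffOn

theorem corollary3p1 :
    -- finite `a`, `f 0 ≠ 0`
    (∀ (a : ℝ) (f : ℝ → ℂ), 0 < a → ComplexAnalyticIn f (Icc 0 a) → f 0 ≠ 0 →
      ∃ P : ℝ → ℂ, (∀ ω ∈ Ioo 0 a, HasPV f a ω (P ω)) ∧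
        P ~[𝓝[>] 0] (fun ω : ℝ => f 0 * ((Real.log ω : ℝ) : ℂ))) ∧
    -- finite `a`, `f = x ^ m * g` with a zero of order `m ≥ 1` at the origin
    (∀ (a : ℝ) (m : ℕ) (f g : ℝ → ℂ), 0 < a → 1 ≤ m → ComplexAnalyticIn g (Icc 0 a) → g 0 ≠ 0 →
      (∀ x ∈ Icc 0 a, f x = (x : ℂ) ^ m * g x) →
      ∃ P : ℝ → ℂ, (∀ ω ∈ Ioo 0 a, HasPV f a ω (P ω)) ∧
        ((∫ x in (0 : ℝ)..a, (x : ℂ) ^ (m - 1) * g x) ≠ 0 →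
          P ~[𝓝[>] 0] (fun _ : ℝ => -∫ x in (0 : ℝ)..a, (x : ℂ) ^ (m - 1) * g x))) ∧
    -- `a = ∞`, `f 0 ≠ 0`
    (∀ f : ℝ → ℂ, ComplexAnalyticIn f (Ici 0) → f 0 ≠ 0 →
      (∃ ω > 0, ∃ v : ℂ, HasPVTop f ω v) →
      ∃ P : ℝ → ℂ, (∀ ω > 0, HasPVTop f ω (P ω)) ∧
        P ~[𝓝[>] 0] (fun ω : ℝ => f 0 * ((Real.log ω : ℝ) : ℂ))) ∧
    -- `a = ∞`, `f = x ^ m * g` with a zero of order `m ≥ 1` at the origin;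
    -- `L` is the (improper) integral of `x ^ (m - 1) * g x` over `[0, ∞)`
    (∀ (m : ℕ) (f g : ℝ → ℂ), 1 ≤ m → ComplexAnalyticIn g (Ici 0) → g 0 ≠ 0 →
      (∀ x ∈ Ici (0 : ℝ), f x = (x : ℂ) ^ m * g x) →
      (∃ ω > 0, ∃ v : ℂ, HasPVTop f ω v) →
      ∃ (P : ℝ → ℂ) (L : ℂ), (∀ ω > 0, HasPVTop f ω (P ω)) ∧
        Tendsto (fun b : ℝ => ∫ x in (0 : ℝ)..b, (x : ℂ) ^ (m - 1) * g x) atTop (𝓝 L) ∧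
        (L ≠ 0 → P ~[𝓝[>] 0] (fun _ : ℝ => -L))) := by

  have hpow : ∀ (m : ℕ) (x z : ℂ), 1 ≤ m → x ^ m * z = x * (x ^ (m - 1) * z) := fun m x z hm => by
    rw [← mul_assoc, ← pow_succ', Nat.sub_add_cancel hm]
  refine ⟨fun a f ha hf h0 => ⟨pvInt f a, fun ω hω => hasPV_pvInt hf.contDiffOn hω, ?_⟩,
    fun a m f g ha hm hg h0 hfg => ⟨pvInt f a, fun ω hω => hasPV_pvInt ?_ hω, fun hL => ?_⟩,
    fun f hf h0 hex => ?_, fun m f g hm hg h0 hfg hex => ?_⟩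
  · exact isEquivalent_mul_log (T := fun _ => 0) ha hf.contDiffOn h0 (isBigO_zero _ _)
      (by simp)
  · exact (hg.contDiffOn_pow_mul m).congr hfg
  · refine (isEquivalent_const_iff_tendsto (neg_ne_zero.2 hL)).2 ?_
    exact tendsto_pvInt_mul_id ha (hg.contDiffOn_pow_mul (m - 1)) fun x hx => by
      rw [hfg x hx, hpow m _ _ hm]
  · obtain ⟨P, T, c, hc, hP, hT, -, hPT⟩ := exists_hasPVTop hf.contDiffOn hex
    exact ⟨P, hP, isEquivalent_mul_log hc (hf.contDiffOn.mono Icc_subset_Ici_self) h0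
      ((hT.tendsto.mono_left nhdsWithin_le_nhds).isBigO_one ℝ) hPT⟩
  · obtain ⟨P, T, c, hc, hP, hT, hT0, hPT⟩ :=
      exists_hasPVTop ((hg.contDiffOn_pow_mul m).congr hfg) hex
    have hh := hg.contDiffOn_pow_mul (m - 1)
    have hint : ∀ p ∈ Ici (0 : ℝ), ∀ q ∈ Ici (0 : ℝ), IntervalIntegrable
        (fun x : ℝ => (x : ℂ) ^ (m - 1) * g x) MeasureTheory.volume p q := fun p hp q hq =>
      (hh.continuousOn.mono ((convex_Ici 0).ordConnected.uIcc_subset hp hq)).intervalIntegrable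
    -- At `ω = 0` the tail integrand `f x / (0 - x)` is `-x ^ (m - 1) * g x`, so `-T 0` is the part
    -- of the improper integral beyond `c`.
    refine ⟨P, (∫ x in (0 : ℝ)..c, (x : ℂ) ^ (m - 1) * g x) - T 0, hP, ?_, fun hL => ?_⟩
    · refine (hT0.const_sub _).congr' ?_
      filter_upwards [eventually_ge_atTop c] with b hb
      rw [← intervalIntegral.integral_add_adjacent_intervals
        (hint 0 self_mem_Ici c hc.le) (hint c hc.le b (hc.le.trans hb)), sub_eq_add_neg,
        ← intervalIntegral.integral_neg]
      congr 1
      refine intervalIntegral.integral_congr fun x hx => ?_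
      rw [uIcc_of_le hb] at hx
      have hx0 : (x : ℂ) ≠ 0 := by exact_mod_cast (hc.trans_le hx.1).ne'
      simp only [hfg x (hc.le.trans hx.1), hpow m _ _ hm]
      rw [Complex.ofReal_zero, zero_sub, div_neg, neg_neg, mul_div_cancel_left₀ _ hx0]
    · refine (isEquivalent_const_iff_tendsto (neg_ne_zero.2 hL)).2 ?_
      have h1 := tendsto_pvInt_mul_id (f := f) hc (hh.mono Icc_subset_Ici_self) fun x hx => by
        rw [hfg x hx.1, hpow m _ _ hm]
      have h2 := h1.add (hT.tendsto.mono_left nhdsWithin_le_nhds)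
      rw [neg_add_eq_sub, ← neg_sub] at h2
      exact h2.congr' hPT.symm
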